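/- For $k,b\in\mathbb{Q}^\times$ let $\phi_{k,b}(z)=kz+\frac{b}{z}$, viewed as a self-map of $\mathbb{P}^1(\mathbb{Q})=\mathbb{Q}\cup\{\infty\}$. Assume Manes' conjecture: if $\phi\in\mathbb{Q}(z)$ is a rational map of degree $2$ whose automorphism group $\{f\in\mathrm{PGL}_2(\overline{\mathbb{Q}}): f^{-1}\circ\phi\circ f=\phi\}$ is isomorphic to $C_2$, then $\phi$ has no rational point of exact period $N>4$. Let $k_1,b_1,k_2,b_2\in\mathbb{Q}^\times$ and $p\in\mathbb{Q}^\times$. Then $p$ is a periodic point of both $\phi_{k_1,b_1}$ and $\phi_{k_2,b_2}$ if and only if, possibly after interchanging the two pairs $(k_1,b_1)$ and $(k_2,b_2)$, they are given by one of the rows of the following table for some $s_1,s_2\in\mathbb{Q}$ (so the tuples $(k_1,b_1,k_2,b_2)$ for which the two maps share a periodic point in $\mathbb{Q}^\times$ are exactly those obtained as $p$ ranges over $\mathbb{Q}^\times$). Here PL denotes the period length, $s_i\in\mathbb{Q}\setminus\{0,1\}$ if the corresponding PL is $1$ or $2$, and $s_i\in\mathbb{Q}\setminus\{0,\pm1\}$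 if it is $4$. $$\begin{array}{|c|c|c|c|c|c|} \hline (k_1,b_1) & \text{Periodic points} & \text{PL} & (k_2,b_2) & \text{Periodic points} & \text{PL}\\ \hline (1-s_1,\ s_1p^2) & p,-p & 1 & (1-s_2,\ s_2p^2) & p,-p & 1\\ \hline (s_1-1,\ -s_1p^2) & p,-p & 2 & (s_2-1,\ -s_2p^2) & p,-p & 2\\ \hline \left(\frac{2s_1}{s_1^2-1},\ -\frac{p^2(s_1^2+1)}{s_1(s_1^2-1)}\right) & p,\frac{p}{s_1},-p,-\frac{p}{s_1} & 4 & \left(\frac{2s_2}{s_2^2-1},\ -\frac{p^2(s_2^2+1)}{s_2(s_2^2-1)}\right) & p,\frac{p}{s_2},-p,-\frac{p}{s_2} & 4\\ \hline (1-s_1,\ s_1p^2) & p,-p & 1 & (s_2-1,\ -s_2p^2) & p,-p & 2\\ \hline (1-s_1,\ s_1p^2) & p,-p & 1 & \left(\frac{2s_2}{s_2^2-1},\ -\frac{p^2(s_2^2+1)}{s_2(s_2^2-1)}\right) & p,\frac{p}{s_2},-p,-\frac{p}{s_2} & 4\\ \hline (s_1-1,\ -s_1p^2) & p,-p & 2 &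 \left(\frac{2s_2}{s_2^2-1},\ -\frac{p^2(s_2^2+1)}{s_2(s_2^2-1)}\right) & p,\frac{p}{s_2},-p,-\frac{p}{s_2} & 4\\ \hline \end{array}$$ Moreover, for every $p\in\mathbb{Q}^\times$ and all admissible $s_1,s_2$, the parameters $k_i,b_i$ in each row are nonzero, and the listed periodic points are exactly the finite rational points of $\phi_{k_i,b_i}$ whose exact period is the given PL. -/

import Mathlib

noncomputable section

/-- The point `[a : b]` of the projective line over `L`, where `OnePoint L = L ∪ {∞}` (used only
when `a` and `b` are not both zero). -/
def projPoint {L : Type*} [Field L] (a b : L) : OnePoint L :=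
  open scoped Classical in if b = 0 then OnePoint.infty else ((a / b : L) : OnePoint L)

namespace RatFunc

/-- The degree of a rational map: the maximum of the degrees of numerator and denominator in
lowest terms. -/
def mapDegree {K : Type*} [Field K] (φ : RatFunc K) : ℕ :=
  max φ.num.natDegree φ.denom.natDegree

/-- The self-map of the projective line over an extension `L` of `K` given by `φ ∈ K(z)`. At `∞`
one takes the coefficients of `z ^ deg φ` in the numerator and the denominator. -/
def projMap {K : Type*} [Field K] (φ : RatFunc K) (L : Type*) [Field L] [Algebra K L]
    (x : OnePoint L) : OnePoint L :=
  x.elim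
    (projPoint (algebraMap K L (φ.num.coeff φ.mapDegree))
      (algebraMap K L (φ.denom.coeff φ.mapDegree)))
    (fun z => projPoint (Polynomial.aeval z φ.num) (Polynomial.aeval z φ.denom))

open scoped Classical in
/-- The matrices `g ∈ GL₂(L)` with `g⁻¹ ∘ φ ∘ g = φ` on the projective line over `L`. For an
infinite field `L` (below, `L` is algebraically closed) this is the same as an equality of rational
maps. -/
def stabilizerGL {K : Type*} [Field K] (φ : RatFunc K) (L : Type*) [Field L] [Algebra K L] :
    Subgroup (Matrix.GeneralLinearGroup (Fin 2) L) where
  carrier := {g | ∀ x : OnePoint L, g⁻¹ • φ.projMap L (g • x) = φ.projMap L x}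
  mul_mem' := by
    intro g h hg hh x
    rw [mul_inv_rev, mul_smul, mul_smul, hg, hh]
  one_mem' := by
    intro x
    simp
  inv_mem' := by
    intro g hg x
    have h := hg (g⁻¹ • x)
    rw [smul_inv_smul] at h
    rw [← h, inv_inv, smul_inv_smul]

/-- `Aut(φ) = {f ∈ PGL₂(K̄) : f⁻¹ ∘ φ ∘ f = φ}`, with `PGL₂ = GL₂ / center`. -/
def autGroup {K : Type*} [Field K] (φ : RatFunc K) :
    Subgroup (Matrix.GeneralLinearGroup (Fin 2) (AlgebraicClosure K) ⧸
      Subgroup.center (Matrix.GeneralLinearGroup (Fin 2) (AlgebraicClosure K))) :=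
  (φ.stabilizerGL (AlgebraicClosure K)).map (QuotientGroup.mk' _)

end RatFunc

/-- Manes' conjecture: a rational map `φ ∈ ℚ(z)` of degree two with `Aut(φ) ≅ C₂` has no rational
point (on the projective line) of exact period `N > 4`. -/
def ManesConjecture : Prop :=
  ∀ φ : RatFunc ℚ, φ.mapDegree = 2 → Nonempty (φ.autGroup ≃* Multiplicative (ZMod 2)) →
    ∀ N : ℕ, 4 < N → ¬ ∃ P : OnePoint ℚ, Function.minimalPeriod (φ.projMap ℚ) P = N

/-- The rational map `φ_{k,b}(z) = k z + b / z`. -/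
def phi (k b : ℚ) : RatFunc ℚ := RatFunc.C k * RatFunc.X + RatFunc.C b / RatFunc.X

/-- The table. Its columns are, for each of the two maps, the parameters `(k, b)`, a set of periodic
points, and their period length. -/
inductive CommonPeriodicTable (p : ℚ) :
    (k₁ b₁ : ℚ) → (points₁ : Set ℚ) → (PL₁ : ℕ) →
    (k₂ b₂ : ℚ) → (points₂ : Set ℚ) → (PL₂ : ℕ) → Prop
  | row11 (s₁ s₂ : ℚ) (h₁ : s₁ ∉ ({0, 1} : Set ℚ)) (h₂ : s₂ ∉ ({0, 1} : Set ℚ)) :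
      CommonPeriodicTable p
        (1 - s₁) (s₁ * p ^ 2) {p, -p} 1
        (1 - s₂) (s₂ * p ^ 2) {p, -p} 1
  | row22 (s₁ s₂ : ℚ) (h₁ : s₁ ∉ ({0, 1} : Set ℚ)) (h₂ : s₂ ∉ ({0, 1} : Set ℚ)) :
      CommonPeriodicTable p
        (s₁ - 1) (-s₁ * p ^ 2) {p, -p} 2
        (s₂ - 1) (-s₂ * p ^ 2) {p, -p} 2
  | row44 (s₁ s₂ : ℚ) (h₁ : s₁ ∉ ({0, 1, -1} : Set ℚ)) (h₂ : s₂ ∉ ({0, 1, -1} : Set ℚ)) :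
      CommonPeriodicTable p
        (2 * s₁ / (s₁ ^ 2 - 1)) (-(p ^ 2 * (s₁ ^ 2 + 1) / (s₁ * (s₁ ^ 2 - 1))))
          {p, p / s₁, -p, -(p / s₁)} 4
        (2 * s₂ / (s₂ ^ 2 - 1)) (-(p ^ 2 * (s₂ ^ 2 + 1) / (s₂ * (s₂ ^ 2 - 1))))
          {p, p / s₂, -p, -(p / s₂)} 4
  | row12 (s₁ s₂ : ℚ) (h₁ : s₁ ∉ ({0, 1} : Set ℚ)) (h₂ : s₂ ∉ ({0, 1} : Set ℚ)) :
      CommonPeriodicTable p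
        (1 - s₁) (s₁ * p ^ 2) {p, -p} 1
        (s₂ - 1) (-s₂ * p ^ 2) {p, -p} 2
  | row14 (s₁ s₂ : ℚ) (h₁ : s₁ ∉ ({0, 1} : Set ℚ)) (h₂ : s₂ ∉ ({0, 1, -1} : Set ℚ)) :
      CommonPeriodicTable p
        (1 - s₁) (s₁ * p ^ 2) {p, -p} 1
        (2 * s₂ / (s₂ ^ 2 - 1)) (-(p ^ 2 * (s₂ ^ 2 + 1) / (s₂ * (s₂ ^ 2 - 1))))
          {p, p / s₂, -p, -(p / s₂)} 4
  | row24 (s₁ s₂ : ℚ) (h₁ : s₁ ∉ ({0, 1} : Set ℚ)) (h₂ : s₂ ∉ ({0, 1, -1} : Set ℚ)) :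
      CommonPeriodicTable p
        (s₁ - 1) (-s₁ * p ^ 2) {p, -p} 2
        (2 * s₂ / (s₂ ^ 2 - 1)) (-(p ^ 2 * (s₂ ^ 2 + 1) / (s₂ * (s₂ ^ 2 - 1))))
          {p, p / s₂, -p, -(p / s₂)} 4

end

/-!
The substance of the theorem is that a periodic point `p ∈ ℚˣ` of `φ = φ_{k,b}` satisfies
`φ(p) = p`, `φ(p) = -p` or `φ(φ(p)) = -p` (`affinePhi_trichotomy`). Each of the three equations is
solved by an explicit one-parameter family `(k, b)`, and these families are the entries of the
table.

Periods greater than four are excluded by Manes' conjecture, which applies when `Aut(φ) ≅ C₂`. A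
matrix commuting with `φ` satisfies a polynomial identity whose coefficients leave only
`z ↦ ± z`, except for `k = -1/2` (`nonempty_autGroup_phi_mulEquiv`). For `k = -1/2` the ratios
`φ(z) / z` along a periodic orbit are 2-adic units and are contracted 2-adically towards `1` or
`-1`, so that they equal `1` or `-1` (`affinePhi_neg_half_eq_or`).

Period three is excluded by the conjecture as well: since `φ` is odd, a point of period three for
`φ_{k,b}` has period six for `-φ_{k,b} = φ_{-k,-b}` (`minimalPeriod_affinePhi_ne_three`).

A rational four-cycle that is not symmetric under `z ↦ -z` gives a rational point with `m ≠ 0` on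
the curve `y² = m⁴ - 6 m² + 1` (`affinePhi_sq_eq_neg_of_period_four`). There is none, by Fermat's
descent for `x⁴ + 4 y⁴ = z²` (`not_pow_four_add_four_mul_pow_four`).
-/

/-! ### The map `φ_{k,b}` on the projective line -/

section ProjectiveMap

open Polynomial in
lemma phi_eq_div (k b : ℚ) :
    phi k b = algebraMap ℚ[X] (RatFunc ℚ) (C k * X ^ 2 + C b) / algebraMap ℚ[X] (RatFunc ℚ) X := by
  have hX : (RatFunc.X : RatFunc ℚ) ≠ 0 := RatFunc.X_ne_zero
  rw [phi]
  simp only [map_add, map_mul, map_pow, RatFunc.algebraMap_C, RatFunc.algebraMap_X]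
  field_simp

open Polynomial in
lemma gcd_quadratic_X {k b : ℚ} (hb : b ≠ 0) : gcd (C k * X ^ 2 + C b) (X : ℚ[X]) = 1 := by
  have h : IsCoprime (C k * X ^ 2 + C b) (X : ℚ[X]) := by
    refine ⟨C b⁻¹, -(C b⁻¹ * C k * X), ?_⟩
    have : C b⁻¹ * C b = (1 : ℚ[X]) := by rw [← C_mul, inv_mul_cancel₀ hb, C_1]
    linear_combination this
  have hu : IsUnit (gcd (C k * X ^ 2 + C b) (X : ℚ[X])) :=
    h.isUnit_of_dvd' (gcd_dvd_left _ _) (gcd_dvd_right _ _)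
  rw [← normalize_gcd]
  exact normalize_eq_one.2 hu

open Polynomial in
lemma phi_num {k b : ℚ} (hb : b ≠ 0) : (phi k b).num = C k * X ^ 2 + C b := by
  rw [phi_eq_div, RatFunc.num_div]
  convert_to C ((X : ℚ[X]) / 1).leadingCoeff⁻¹ * ((C k * X ^ 2 + C b) / 1) = _
  · congr! <;> first | rfl | (convert gcd_quadratic_X (k := k) hb <;> rfl)
  · simp

open Polynomial in
lemma phi_denom {k b : ℚ} (hb : b ≠ 0) : (phi k b).denom = X := by
  rw [phi_eq_div, RatFunc.denom_div _ X_ne_zero]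
  convert_to C ((X : ℚ[X]) / 1).leadingCoeff⁻¹ * (X / 1) = _
  · congr! <;> first | rfl | (convert gcd_quadratic_X (k := k) hb <;> rfl)
  · simp

lemma phi_mapDegree {k b : ℚ} (hk : k ≠ 0) (hb : b ≠ 0) : (phi k b).mapDegree = 2 := by
  rw [RatFunc.mapDegree, phi_num hb, phi_denom hb]
  have : (Polynomial.C k * Polynomial.X ^ 2 + Polynomial.C b : Polynomial ℚ).natDegree = 2 := by
    compute_degree!
  rw [this]
  simp

variable {L : Type*} [Field L]

lemma projPoint_mul_eq {a b a' b' : L} (h : projPoint a b = projPoint a' b') :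
    a * b' = a' * b := by
  unfold projPoint at h
  split_ifs at h with h₁ h₂ h₂
  · simp [h₁, h₂]
  · exact (OnePoint.infty_ne_coe _ h).elim
  · exact (OnePoint.coe_ne_infty _ h).elim
  · rwa [OnePoint.coe_eq_coe, div_eq_div_iff h₁ h₂] at h

lemma projPoint_eq_of_mul_eq {a b a' b' : L} (h : a ≠ 0 ∨ b ≠ 0) (h' : a' ≠ 0 ∨ b' ≠ 0)
    (e : a * b' = a' * b) : projPoint a b = projPoint a' b' := by
  unfold projPoint
  split_ifs with h₁ h₂ h₂
  · rfl
  · simp_all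
  · simp_all
  · rw [OnePoint.coe_eq_coe, div_eq_div_iff h₁ h₂, e]

@[simp] lemma projPoint_one_zero : projPoint (1 : L) 0 = OnePoint.infty := by simp [projPoint]

@[simp] lemma projPoint_one_right (z : L) : projPoint z 1 = z := by simp [projPoint]

lemma projMap_phi_projPoint [Algebra ℚ L] {k b : ℚ} (hk : k ≠ 0) (hb : b ≠ 0) {x y : L}
    (h : x ≠ 0 ∨ y ≠ 0) :
    (phi k b).projMap L (projPoint x y) =
      projPoint (algebraMap ℚ L k * x ^ 2 + algebraMap ℚ L b * y ^ 2) (x * y) := by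
  have hk' : algebraMap ℚ L k ≠ 0 := (map_ne_zero _).2 hk
  have hb' : algebraMap ℚ L b ≠ 0 := (map_ne_zero _).2 hb
  unfold RatFunc.projMap
  rw [phi_mapDegree hk hb, phi_num hb, phi_denom hb]
  by_cases hy : y = 0
  · subst hy
    simp [projPoint, Polynomial.coeff_X]
  · have : projPoint x y = ((x / y : L) : OnePoint L) := by simp [projPoint, hy]
    rw [this]
    simp only [OnePoint.elim_some, map_add, map_mul, map_pow, Polynomial.aeval_C,
      Polynomial.aeval_X]
    by_cases hx : x = 0
    · simp [projPoint, hx]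
    · apply projPoint_eq_of_mul_eq
      · exact Or.inr (div_ne_zero hx hy)
      · exact Or.inr (mul_ne_zero hx hy)
      · field_simp

open scoped Classical in
lemma smul_projPoint (g : Matrix.GeneralLinearGroup (Fin 2) L) {x y : L} (h : x ≠ 0 ∨ y ≠ 0) :
    g • projPoint x y = projPoint (g 0 0 * x + g 0 1 * y) (g 1 0 * x + g 1 1 * y) := by
  by_cases hy : y = 0
  · subst hy
    have hx : x ≠ 0 := by simpa using h
    simp only [projPoint, if_true, OnePoint.smul_infty_eq_ite, mul_zero, add_zero, mul_eq_zero, hx,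
      or_false]
    split_ifs
    · rfl
    · rw [mul_div_mul_right _ _ hx]
  · simp only [projPoint, hy, if_false, OnePoint.smul_some_eq_ite]
    have e : ∀ c d : L, c * (x / y) + d = (c * x + d * y) / y := by intros; field_simp
    simp only [e, div_eq_zero_iff, hy, or_false]
    split_ifs
    · rfl
    · rw [div_div_div_cancel_right₀ hy]

end ProjectiveMap

/-! ### The automorphism group -/

section Automorphisms

open scoped Classical

variable {L : Type*} [Field L] [Algebra ℚ L]

/-- The entries of a matrix commuting with `k z + b / z` satisfy a polynomial identity in `z`, whose
coefficients force the matrix to be `diag (a, ± a)`. -/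
lemma diagonal_of_commute {k b a c d e : L} (hk : k ≠ 0) (hb : b ≠ 0) (hk2 : 2 * k + 1 ≠ 0)
    (hdet : a * d - e * c ≠ 0)
    (h : ∀ z : L, (a * (k * z ^ 2 + b) + e * z) * ((a * z + e) * (c * z + d)) =
      (k * (a * z + e) ^ 2 + b * (c * z + d) ^ 2) * (c * (k * z ^ 2 + b) + d * z)) :
    e = 0 ∧ c = 0 ∧ (a = d ∨ a = -d) := by
  have : CharZero L := algebraRat.charZero L
  have h0 := h 0
  have h1 := h 1
  have h2 := h (-1)
  have h3 := h 2
  have h4 := h (-2)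
  have c0 : b * (a * e * d - c * (k * e ^ 2 + b * d ^ 2)) = 0 := by linear_combination h0
  have c4 : k * c * (a ^ 2 - k * a ^ 2 - b * c ^ 2) = 0 := by
    have : (24 : L) * (k * c * (a ^ 2 - k * a ^ 2 - b * c ^ 2)) = 0 := by
      linear_combination h3 + h4 - 4 * h1 - 4 * h2 + 6 * h0
    simpa using this
  have c3 : a * k * (a * d + e * c) + e * a * c
      - (k * a ^ 2 + b * c ^ 2) * d - (2 * k * a * e + 2 * b * c * d) * (c * k) = 0 := by
    have : (12 : L) * (a * k * (a * d + e * c) + e * a * c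
      - (k * a ^ 2 + b * c ^ 2) * d - (2 * k * a * e + 2 * b * c * d) * (c * k)) = 0 := by
      linear_combination h3 - h4 - 2 * h1 + 2 * h2
    simpa using this
  have c1 : a * b * (a * d + e * c) + e * e * d
      - (k * e ^ 2 + b * d ^ 2) * d - (2 * k * a * e + 2 * b * c * d) * (c * b) = 0 := by
    have : (12 : L) * (a * b * (a * d + e * c) + e * e * d
      - (k * e ^ 2 + b * d ^ 2) * d - (2 * k * a * e + 2 * b * c * d) * (c * b)) = 0 := by
      linear_combination 8 * h1 - 8 * h2 - h3 + h4
    simpa using this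
  have hc : c = 0 := by
    by_contra hc
    have c4' : a ^ 2 - k * a ^ 2 - b * c ^ 2 = 0 := by simpa [hk, hc] using c4
    have ha : a ≠ 0 := by
      rintro rfl
      simp [hb, hc] at c4'
    -- The multiplier `1 / k` of the fixed point `∞` would equal the multiplier `2 k - 1` of the
    -- finite fixed points.
    have key : (2 * k + 1) * (k - 1) * a * (a * d - e * c) = 0 := by
      linear_combination c3 - (d + 2 * k * d) * c4'
    have hk1 : k = 1 := by
      have : k - 1 = 0 := by simpa [hk2, ha, hdet] using key
      linear_combination this
    simp [hk1, hb, hc] at c4'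
  subst hc
  have ha : a ≠ 0 := by
    rintro rfl
    simp at hdet
  have hd : d ≠ 0 := by
    rintro rfl
    simp at hdet
  have he : e = 0 := by simpa [hb, ha, hd] using c0
  subst he
  refine ⟨rfl, rfl, ?_⟩
  have : b * d * ((a - d) * (a + d)) = 0 := by linear_combination c1
  have : (a - d) * (a + d) = 0 := by simpa [hb, hd] using this
  rcases mul_eq_zero.1 this with h | h
  · exact Or.inl (by linear_combination h)
  · exact Or.inr (by linear_combination h)

lemma mem_stabilizerGL_phi_iff {k b : ℚ} (hk : k ≠ 0) (hb : b ≠ 0) (hk2 : k ≠ -1 / 2)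
    (g : Matrix.GeneralLinearGroup (Fin 2) L) :
    g ∈ (phi k b).stabilizerGL L ↔
      g 0 1 = 0 ∧ g 1 0 = 0 ∧ (g 0 0 = g 1 1 ∨ g 0 0 = -g 1 1) := by
  have hk' : algebraMap ℚ L k ≠ 0 := (map_ne_zero _).2 hk
  have hb' : algebraMap ℚ L b ≠ 0 := (map_ne_zero _).2 hb
  have hdet : g 0 0 * g 1 1 - g 0 1 * g 1 0 ≠ 0 := by
    have := g.det_ne_zero
    rwa [Matrix.det_fin_two] at this
  have hg (x y : L) (h : x ≠ 0 ∨ y ≠ 0) :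
      g 0 0 * x + g 0 1 * y ≠ 0 ∨ g 1 0 * x + g 1 1 * y ≠ 0 := by
    by_contra! hc
    have hx : (g 0 0 * g 1 1 - g 0 1 * g 1 0) * x = 0 := by
      linear_combination g 1 1 * hc.1 - g 0 1 * hc.2
    have hy : (g 0 0 * g 1 1 - g 0 1 * g 1 0) * y = 0 := by
      linear_combination g 0 0 * hc.2 - g 1 0 * hc.1
    simp_all
  have hφ (x y : L) (h : x ≠ 0 ∨ y ≠ 0) :
      algebraMap ℚ L k * x ^ 2 + algebraMap ℚ L b * y ^ 2 ≠ 0 ∨ x * y ≠ 0 := by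
    by_cases hx : x = 0 <;> by_cases hy : y = 0 <;> simp_all
  have hcomm : g ∈ (phi k b).stabilizerGL L ↔
      ∀ x : OnePoint L, (phi k b).projMap L (g • x) = g • (phi k b).projMap L x := by
    refine forall_congr' fun x => ?_
    rw [inv_smul_eq_iff]
  rw [hcomm]
  constructor
  · intro H
    refine diagonal_of_commute hk' hb' ?_ hdet fun z => ?_
    · intro h
      apply hk2
      have : algebraMap ℚ L (2 * k + 1) = 0 := by
        rw [← h]; simp only [map_add, map_mul, map_one, map_ofNat]
      rw [map_eq_zero] at this
      linarith
    · have hz : z ≠ 0 ∨ (1 : L) ≠ 0 := Or.inr one_ne_zero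
      have := H (projPoint z 1)
      rw [smul_projPoint g hz, projMap_phi_projPoint hk hb (hg _ _ hz),
        projMap_phi_projPoint hk hb hz, smul_projPoint g (hφ _ _ hz)] at this
      linear_combination -projPoint_mul_eq this
  · rintro ⟨h01, h10, h⟩ x
    obtain ⟨u, v, huv, rfl⟩ : ∃ u v : L, (u ≠ 0 ∨ v ≠ 0) ∧ x = projPoint u v := by
      induction x using OnePoint.rec with
      | infty => exact ⟨1, 0, by simp, by simp⟩
      | coe z => exact ⟨z, 1, by simp, by simp⟩
    rw [smul_projPoint g huv, projMap_phi_projPoint hk hb (hg _ _ huv),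
      projMap_phi_projPoint hk hb huv, smul_projPoint g (hφ _ _ huv)]
    refine projPoint_eq_of_mul_eq (hφ _ _ (hg _ _ huv)) (hg _ _ (hφ _ _ huv)) ?_
    rw [h01, h10]
    rcases h with h | h <;> rw [h] <;> ring

lemma mem_center_iff_fin_two {F : Type*} [Field F] (g : Matrix.GeneralLinearGroup (Fin 2) F) :
    g ∈ Subgroup.center (Matrix.GeneralLinearGroup (Fin 2) F) ↔
      g 0 1 = 0 ∧ g 1 0 = 0 ∧ g 0 0 = g 1 1 := by
  rw [Matrix.GeneralLinearGroup.mem_center_iff_val_mem_range_scalar]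
  constructor
  · rintro ⟨t, ht⟩
    simp [← ht]
  · rintro ⟨h₁, h₂, h₃⟩
    refine ⟨g 0 0, ?_⟩
    ext i j
    fin_cases i <;> fin_cases j <;> simp [h₁, h₂, h₃]

/-- `Aut(φ_{k,b})` consists of the classes of `1` and `diag (-1, 1)`. For `k = -1/2` the map is
conjugate to `z⁻²`, and its automorphism group is larger. -/
lemma nonempty_autGroup_phi_mulEquiv {k b : ℚ} (hk : k ≠ 0) (hb : b ≠ 0) (hk2 : k ≠ -1 / 2) :
    Nonempty ((phi k b).autGroup ≃* Multiplicative (ZMod 2)) := by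
  let s : Matrix.GeneralLinearGroup (Fin 2) (AlgebraicClosure ℚ) :=
    Matrix.GeneralLinearGroup.mkOfDetNeZero !![-1, 0; 0, 1] (by simp)
  have hs00 : s 0 0 = -1 := rfl
  have hs01 : s 0 1 = 0 := rfl
  have hs10 : s 1 0 = 0 := rfl
  have hs11 : s 1 1 = 1 := rfl
  have hmem : s ∈ (phi k b).stabilizerGL (AlgebraicClosure ℚ) := by
    rw [mem_stabilizerGL_phi_iff hk hb hk2]
    exact ⟨hs01, hs10, Or.inr (by rw [hs00, hs11])⟩
  have hss : s * s = 1 := by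
    ext i j
    rw [Matrix.GeneralLinearGroup.coe_mul, Matrix.mul_apply, Fin.sum_univ_two]
    fin_cases i <;> fin_cases j <;> simp [s]
  have hcard : Nat.card (phi k b).autGroup = 2 := by
    rw [Nat.card_eq_two_iff]
    refine ⟨1, ⟨QuotientGroup.mk' _ s, Subgroup.mem_map_of_mem _ hmem⟩, ?_, ?_⟩
    · intro h
      have h1 : QuotientGroup.mk' (Subgroup.center
          (Matrix.GeneralLinearGroup (Fin 2) (AlgebraicClosure ℚ))) s = 1 :=
        (congrArg Subtype.val h).symm
      rw [QuotientGroup.mk'_apply, QuotientGroup.eq_one_iff, mem_center_iff_fin_two, hs00,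
        hs11] at h1
      have : (2 : AlgebraicClosure ℚ) = 0 := by linear_combination -h1.2.2
      exact two_ne_zero this
    · refine Set.eq_univ_of_forall fun x => ?_
      obtain ⟨_, g, hg, rfl⟩ := x
      obtain ⟨h01, h10, h⟩ := (mem_stabilizerGL_phi_iff hk hb hk2 g).1 hg
      rcases h with h | h
      · refine Or.inl (Subtype.ext ?_)
        change QuotientGroup.mk' _ g = 1
        rw [QuotientGroup.mk'_apply, QuotientGroup.eq_one_iff, mem_center_iff_fin_two]
        exact ⟨h01, h10, h⟩
      · refine Or.inr (Subtype.ext ?_)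
        change QuotientGroup.mk' _ g = QuotientGroup.mk' _ s
        refine ((QuotientGroup.mk'_eq_mk' _).2 ⟨s * g, ?_, ?_⟩).symm
        · rw [mem_center_iff_fin_two]
          simp [Matrix.mul_apply, Fin.sum_univ_two, hs00, hs01,
            hs10, hs11, h01, h10, h]
        · rw [← mul_assoc, hss, one_mul]
  have : Fact (Nat.Prime 2) := ⟨Nat.prime_two⟩
  exact ⟨mulEquivOfPrimeCardEq (p := 2) hcard (by simp)⟩

end Automorphisms

/-! ### A Diophantine equation of Fermat -/

section Diophantine

/-- Fermat's infinite descent for `x⁴ + 4 y⁴ = z²`: a primitive solution with `x` odd yields, by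
two applications of the classification of Pythagorean triples, a solution with a smaller `z`. -/
theorem not_pow_four_add_four_mul_pow_four (n : ℕ) :
    ∀ x y z : ℤ, z.natAbs = n → x ≠ 0 → y ≠ 0 → x ^ 4 + 4 * y ^ 4 ≠ z ^ 2 := by
  induction n using Nat.strong_induction_on with
  | _ n ih =>
  intro x y z hn hx hy h
  have hz : z ≠ 0 := by
    rintro rfl
    have : 0 < x ^ 4 := by positivity
    nlinarith [sq_nonneg (y ^ 2)]
  by_cases hg : Int.gcd x y = 1
  swap
  · -- Divide out a common prime factor.
    obtain ⟨q, hq, hqg⟩ := Nat.exists_prime_and_dvd hg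
    obtain ⟨x', rfl⟩ : (q : ℤ) ∣ x := (Int.natCast_dvd_natCast.2 hqg).trans (Int.gcd_dvd_left ..)
    obtain ⟨y', rfl⟩ : (q : ℤ) ∣ y := (Int.natCast_dvd_natCast.2 hqg).trans (Int.gcd_dvd_right ..)
    obtain ⟨z', rfl⟩ : (q : ℤ) ^ 2 ∣ z := by
      rw [← Int.pow_dvd_pow_iff two_ne_zero, ← h]
      exact ⟨x' ^ 4 + 4 * y' ^ 4, by ring⟩
    have hq0 : (q : ℤ) ≠ 0 := by exact_mod_cast hq.ne_zero
    refine ih z'.natAbs ?_ x' y' z' rfl (right_ne_zero_of_mul hx) (right_ne_zero_of_mul hy) ?_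
    · rw [← hn, Int.natAbs_mul]
      have h1 : 0 < z'.natAbs := Int.natAbs_pos.2 (right_ne_zero_of_mul hz)
      have h2 : 1 < ((q : ℤ) ^ 2).natAbs := by
        rw [Int.natAbs_pow, Int.natAbs_natCast]
        exact Nat.one_lt_pow two_ne_zero hq.one_lt
      nlinarith
    · have : (q : ℤ) ^ 4 * (x' ^ 4 + 4 * y' ^ 4 - z' ^ 2) = 0 := by linear_combination h
      have := (mul_eq_zero.1 this).resolve_left (pow_ne_zero 4 hq0)
      linear_combination this
  rcases Int.even_or_odd x with hxe | hxo
  · -- An even `x` can be exchanged with `y`.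
    obtain ⟨x', rfl⟩ := hxe.two_dvd
    obtain ⟨z', rfl⟩ : (2 : ℤ) ∣ z := by
      rw [← Int.pow_dvd_pow_iff two_ne_zero, ← h]
      exact ⟨4 * x' ^ 4 + y ^ 4, by ring⟩
    refine ih z'.natAbs ?_ y x' z' rfl hy (right_ne_zero_of_mul hx) (by linarith)
    have h1 : 0 < z'.natAbs := Int.natAbs_pos.2 (right_ne_zero_of_mul hz)
    rw [← hn, Int.natAbs_mul]
    simp only [Int.reduceAbs]
    omega
  have hc : IsCoprime x y := Int.isCoprime_iff_gcd_eq_one.2 hg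
  have hx2 : IsCoprime x 2 := by
    obtain ⟨t, rfl⟩ := hxo
    exact ⟨1, -t, by ring⟩
  -- First Pythagorean triple: `(x², 2 y², |z|)`.
  have hP : PythagoreanTriple (x ^ 2) (2 * y ^ 2) |z| := by
    unfold PythagoreanTriple
    rw [abs_mul_abs_self]
    linear_combination h
  obtain ⟨r, s, hxr, hyr, hzr, hrs, hpar, hr0⟩ := hP.coprime_classification'
    (Int.isCoprime_iff_gcd_eq_one.1 ((hx2.mul_right hc.pow_right).pow_left))
    (Int.odd_iff.1 hxo.pow) (abs_pos.2 hz)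
  have hrsy : r * s = y ^ 2 := by linarith
  have hy2 : 0 < y ^ 2 := by positivity
  have hr : 0 < r := lt_of_le_of_ne hr0 (by rintro rfl; simp at hrsy; omega)
  have hs0 : 0 < s := pos_of_mul_pos_right (hrsy ▸ hy2) hr0
  obtain ⟨u, hu | hu⟩ := Int.sq_of_gcd_eq_one hrs hrsy
  swap
  · linarith [sq_nonneg u]
  obtain ⟨v, hv | hv⟩ := Int.sq_of_gcd_eq_one (Int.gcd_comm r s ▸ hrs) ((mul_comm s r).trans hrsy)
  swap
  · linarith [sq_nonneg v]
  -- Second Pythagorean triple: `(x, s, r)`.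
  have hQ : PythagoreanTriple x s r := by
    unfold PythagoreanTriple
    linear_combination hxr
  have hxs : Int.gcd x s = 1 := by
    rw [← Int.isCoprime_iff_gcd_eq_one]
    have : IsCoprime (x ^ 2) s := by
      have h' : IsCoprime (r ^ 2) s := (Int.isCoprime_iff_gcd_eq_one.2 hrs).pow_left
      rw [hxr, show r ^ 2 - s ^ 2 = r ^ 2 + s * (-s) by ring]
      exact h'.add_mul_left_left _
    exact (IsCoprime.pow_left_iff two_pos).1 this
  obtain ⟨m, n', -, hsm, hrm, hmn, hmpar, hm0⟩ :=
    hQ.coprime_classification' hxs (Int.odd_iff.1 hxo) hr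
  have hu_lt : u.natAbs < n := by
    have h1 : u ^ 2 < |z| := by rw [hzr, ← hu]; nlinarith
    have h2 : |u| ≤ u ^ 2 := by
      rw [← sq_abs]
      nlinarith [Int.one_le_abs (z := u) (by rintro rfl; simp [hu] at hr)]
    have h3 : |u| < |z| := h2.trans_lt h1
    rw [Int.abs_eq_natAbs, Int.abs_eq_natAbs, hn] at h3
    exact_mod_cast h3
  have hm0' : 0 < m := by
    refine lt_of_le_of_ne hm0 ?_
    rintro rfl
    simp at hsm
    omega
  have hn0' : 0 < n' := by
    by_contra! hn'
    nlinarith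
  -- In `2 m n' = v²` one of `m`, `n'` is twice a square and the other one is a square.
  have key : ∀ c d : ℤ, 0 < c → 0 < d → Int.gcd c d = 1 → 2 * c * d = v ^ 2 →
      u ^ 2 = c ^ 2 + d ^ 2 → c % 2 = 0 → False := by
    intro c d hc0 hd0 hcd hcdv hucd hc2
    obtain ⟨e, rfl⟩ := Int.dvd_of_emod_eq_zero hc2
    obtain ⟨w, rfl⟩ : (2 : ℤ) ∣ v := by
      refine Int.prime_two.dvd_of_dvd_pow (n := 2) ?_
      rw [← hcdv]
      exact ⟨2 * e * d, by ring⟩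
    have hed : Int.gcd e d = 1 := by
      rw [← Int.isCoprime_iff_gcd_eq_one] at hcd ⊢
      exact hcd.of_mul_left_right
    have he0 : 0 < e := by omega
    have hedw : e * d = w ^ 2 := by linarith
    obtain ⟨f, hf | hf⟩ := Int.sq_of_gcd_eq_one hed hedw
    swap
    · linarith [sq_nonneg f]
    obtain ⟨g, hg | hg⟩ :=
      Int.sq_of_gcd_eq_one (Int.gcd_comm e d ▸ hed) ((mul_comm d e).trans hedw)
    swap
    · linarith [sq_nonneg g]
    refine ih _ hu_lt g f u rfl ?_ ?_ ?_
    · rintro rfl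
      omega
    · rintro rfl
      omega
    · rw [hucd, hf, hg]
      ring
  rcases hmpar with ⟨h1, -⟩ | ⟨-, h1⟩
  · exact key m n' hm0' hn0' hmn (by rw [← hsm, hv]) (by rw [← hu, hrm]) h1
  · exact key n' m hn0' hm0' (Int.gcd_comm m n' ▸ hmn) (by rw [← hv, hsm]; ring)
      (by rw [← hu, hrm]; ring) h1

/-- The elliptic curve `y² = x⁴ - 6 x² + 1` has no affine rational points with `x ≠ 0`. -/
theorem sq_sub_one_sq_sub_ne_sq {m y : ℚ} (hm : m ≠ 0) : (m ^ 2 - 1) ^ 2 - (2 * m) ^ 2 ≠ y ^ 2 := by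
  intro h
  -- With `c = m² + 1`, one has `(c y)² = a⁴ - d⁴` for `a = m² - 1` and `d = 2 m`.
  have key : ((m ^ 2 + 1) * y) ^ 4 + 4 * ((m ^ 2 - 1) * (2 * m)) ^ 4 =
      ((m ^ 2 - 1) ^ 4 + (2 * m) ^ 4) ^ 2 := by
    have h2 : ((m ^ 2 + 1) * y) ^ 2 = (m ^ 2 - 1) ^ 4 - (2 * m) ^ 4 := by
      rw [mul_pow, ← h]; ring
    linear_combination (((m ^ 2 + 1) * y) ^ 2 + ((m ^ 2 - 1) ^ 4 - (2 * m) ^ 4)) * h2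
  have hm1 : m ^ 2 - 1 ≠ 0 := by
    intro h1
    rw [h1] at h
    have : 0 < (2 * m) ^ 2 := by positivity
    nlinarith [sq_nonneg y]
  have hy : y ≠ 0 := by
    rintro rfl
    have h2 : (m ^ 2 - 1 - 2 * m) * (m ^ 2 - 1 + 2 * m) = 0 := by linear_combination h
    have h3 : ¬ IsSquare (2 : ℚ) := by
      rw [show (2 : ℚ) = ((2 : ℕ) : ℚ) by norm_num, Rat.isSquare_natCast_iff]
      exact Nat.prime_two.prime.not_isSquare
    rcases mul_eq_zero.1 h2 with h2 | h2
    · exact h3 ⟨m - 1, by linear_combination -h2⟩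
    · exact h3 ⟨m + 1, by linear_combination -h2⟩
  generalize hX : (m ^ 2 + 1) * y = X at key
  generalize hY : (m ^ 2 - 1) * (2 * m) = Y at key
  generalize (m ^ 2 - 1) ^ 4 + (2 * m) ^ 4 = Z at key
  have hX0 : X ≠ 0 := hX ▸ mul_ne_zero (by positivity) hy
  have hY0 : Y ≠ 0 := hY ▸ mul_ne_zero hm1 (by positivity)
  have hXd : (X.den : ℚ) ≠ 0 := by exact_mod_cast X.den_ne_zero
  have hYd : (Y.den : ℚ) ≠ 0 := by exact_mod_cast Y.den_ne_zero
  have hZd : (Z.den : ℚ) ≠ 0 := by exact_mod_cast Z.den_ne_zero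
  -- Clear denominators with `D = X.den * Y.den * Z.den`.
  refine not_pow_four_add_four_mul_pow_four _ (X.num * (Y.den * Z.den)) (Y.num * (X.den * Z.den))
    (Z.num * (X.den * Y.den) * (X.den * Y.den * Z.den)) rfl ?_ ?_ ?_
  · exact mul_ne_zero (Rat.num_ne_zero.2 hX0) (by positivity)
  · exact mul_ne_zero (Rat.num_ne_zero.2 hY0) (by positivity)
  · rw [← Rat.num_div_den X, ← Rat.num_div_den Y, ← Rat.num_div_den Z] at key
    have : ((X.num * (Y.den * Z.den) : ℚ)) ^ 4 + 4 * (Y.num * (X.den * Z.den)) ^ 4 =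
        (Z.num * (X.den * Y.den) * (X.den * Y.den * Z.den)) ^ 2 := by
      field_simp at key
      linear_combination Z.den ^ 2 * key
    exact_mod_cast this

end Diophantine

/-! ### Reduction to a map on `ℚ` -/

/-- The map `z ↦ k z + b / z` on `ℚ`. By the convention `b / 0 = 0` it fixes `0`, so that `0` plays
the role of the fixed point `∞` into which `0` is mapped on the projective line. -/
def affinePhi (k b z : ℚ) : ℚ := k * z + b / z

section Affine

open Function

variable {k b : ℚ}

@[simp] lemma affinePhi_zero (k b : ℚ) : affinePhi k b 0 = 0 := by simp [affinePhi]

lemma affinePhi_neg_right (k b z : ℚ) : affinePhi k b (-z) = -affinePhi k b z := by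
  simp only [affinePhi, div_neg]
  ring

lemma affinePhi_neg_neg (k b z : ℚ) : affinePhi (-k) (-b) z = -affinePhi k b z := by
  simp only [affinePhi, neg_div]
  ring

/-- Collapsing `∞` to `0` turns `φ_{k,b}` into `affinePhi k b`. The collapse is injective away from
`0`, so that no information on nonzero periodic points is lost. -/
lemma semiconj_affinePhi (hk : k ≠ 0) (hb : b ≠ 0) :
    Semiconj (fun x : OnePoint ℚ => x.elim 0 id) ((phi k b).projMap ℚ) (affinePhi k b) := by
  intro x
  obtain ⟨u, v, huv, rfl, hv⟩ : ∃ u v : ℚ, (u ≠ 0 ∨ v ≠ 0) ∧ x = projPoint u v ∧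
      x.elim 0 id = u / v := by
    induction x using OnePoint.rec with
    | infty => exact ⟨1, 0, by simp, by simp, by simp⟩
    | coe z => exact ⟨z, 1, by simp, by simp, by simp⟩
  simp only [hv, projMap_phi_projPoint hk hb huv, affinePhi]
  by_cases h1 : u = 0 <;> by_cases h2 : v = 0 <;> simp [projPoint, h1, h2]
  field_simp

lemma isPeriodicPt_coe_iff (hk : k ≠ 0) (hb : b ≠ 0) {p : ℚ} (hp : p ≠ 0) (n : ℕ) :
    IsPeriodicPt ((phi k b).projMap ℚ) n (p : OnePoint ℚ) ↔ IsPeriodicPt (affinePhi k b) n p := by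
  have h := (semiconj_affinePhi hk hb).iterate_right n (p : OnePoint ℚ)
  simp only [OnePoint.elim_some, id] at h
  unfold IsPeriodicPt IsFixedPt
  rw [← h]
  constructor
  · intro h'
    simp [h']
  · generalize ((phi k b).projMap ℚ)^[n] p = x
    induction x using OnePoint.rec with
    | infty => exact fun h' => absurd h'.symm hp
    | coe z => exact fun h' => congrArg _ h'

lemma minimalPeriod_coe (hk : k ≠ 0) (hb : b ≠ 0) {p : ℚ} (hp : p ≠ 0) :
    minimalPeriod ((phi k b).projMap ℚ) (p : OnePoint ℚ) = minimalPeriod (affinePhi k b) p :=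
  minimalPeriod_eq_minimalPeriod_iff.2 (isPeriodicPt_coe_iff hk hb hp)

lemma minimalPeriod_coe_zero (hk : k ≠ 0) (hb : b ≠ 0) :
    minimalPeriod ((phi k b).projMap ℚ) ((0 : ℚ) : OnePoint ℚ) = 0 := by
  have h0 : (phi k b).projMap ℚ ((0 : ℚ) : OnePoint ℚ) = OnePoint.infty := by
    have := projMap_phi_projPoint (L := ℚ) hk hb (x := 0) (y := 1) (by simp)
    simpa [projPoint] using this
  have hi : (phi k b).projMap ℚ OnePoint.infty = OnePoint.infty := by
    have := projMap_phi_projPoint (L := ℚ) hk hb (x := 1) (y := 0) (by simp)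
    simpa [projPoint] using this
  refine minimalPeriod_eq_zero_of_notMem_periodicPts ?_
  rintro ⟨n, hn, h⟩
  obtain ⟨m, rfl⟩ := Nat.exists_eq_succ_of_ne_zero hn.ne'
  have : ((phi k b).projMap ℚ)^[m + 1] ((0 : ℚ) : OnePoint ℚ) = OnePoint.infty := by
    rw [iterate_succ_apply, h0]
    exact iterate_fixed hi m
  exact OnePoint.infty_ne_coe _ (this.symm.trans h)

lemma affinePhi_iterate_ne_zero {p : ℚ} (hp : p ≠ 0) {n : ℕ} (hn : 0 < n)
    (h : IsPeriodicPt (affinePhi k b) n p) (m : ℕ) : (affinePhi k b)^[m] p ≠ 0 := by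
  intro h0
  have h1 : (affinePhi k b)^[n * m] p = p := (h.mul_const m).eq
  obtain ⟨j, hj⟩ := Nat.exists_eq_add_of_le' (Nat.le_mul_of_pos_left m hn)
  rw [hj, iterate_add_apply, h0, iterate_fixed (affinePhi_zero k b)] at h1
  exact hp h1.symm

end Affine

/-! ### The exceptional parameter `k = -1/2` -/

section TwoAdic

lemma padicNorm_two : padicNorm 2 (2 : ℚ) = 1 / 2 := by
  rw [one_div]
  exact_mod_cast padicNorm.padicNorm_p_of_prime (p := 2)

/-- The residue field of `ℤ_(2)` has two elements. -/
lemma padicNorm_two_le_half_or {x : ℚ} (hx : padicNorm 2 x ≤ 1) :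
    padicNorm 2 x ≤ 1 / 2 ∨ padicNorm 2 (1 - x) ≤ 1 / 2 := by
  have hdvd (m : ℤ) (hm : (2 : ℤ) ∣ m) : padicNorm 2 (m : ℚ) ≤ 1 / 2 := by
    have := (padicNorm.dvd_iff_norm_le (p := 2) (n := 1) (z := m)).1 (by simpa using hm)
    norm_num at this
    linarith
  have hx' : x = x.num / x.den := (Rat.num_div_den x).symm
  have hd0 : (x.den : ℚ) ≠ 0 := by exact_mod_cast x.den_ne_zero
  have hden : padicNorm 2 (x.den : ℚ) = 1 := by
    rw [padicNorm.nat_eq_one_iff]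
    intro h2
    have hnum : padicNorm 2 (x.num : ℚ) = 1 := by
      rw [padicNorm.int_eq_one_iff]
      intro h3
      have := Nat.dvd_gcd (Int.natCast_dvd.1 h3) h2
      rw [x.reduced] at this
      omega
    have h4 := hdvd x.den (by exact_mod_cast h2)
    rw [hx', padicNorm.div, hnum] at hx
    have h5 : 0 < padicNorm 2 (x.den : ℚ) :=
      lt_of_le_of_ne (padicNorm.nonneg _) (padicNorm.nonzero hd0).symm
    rw [div_le_one h5] at hx
    push_cast at h4
    linarith
  have hodd : ¬ (2 : ℤ) ∣ x.den := by
    rw [padicNorm.nat_eq_one_iff] at hden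
    exact_mod_cast hden
  rcases Int.emod_two_eq_zero_or_one x.num with h | h
  · left
    rw [hx', padicNorm.div, hden, div_one]
    exact hdvd _ (by omega)
  · right
    have : 1 - x = ((x.den - x.num : ℤ) : ℚ) / x.den := by
      push_cast
      rw [sub_div, div_self hd0, ← hx']
    rw [this, padicNorm.div, hden, div_one]
    exact hdvd _ (by omega)

/-- For `k = -1/2` and an orbit `z`, the map taking the ratio `φ(z) / z` to the next ratio
`φ(φ(z)) / φ(z)`. -/
def ratioStep (r : ℚ) : ℚ := (1 + 2 * r - r ^ 2) / (2 * r ^ 2)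

lemma one_lt_padicNorm_ratioStep {r : ℚ} (hr : r ≠ 0) (h : padicNorm 2 r ≠ 1) :
    1 < padicNorm 2 (ratioStep r) := by
  have h0 : 0 < padicNorm 2 r := lt_of_le_of_ne (padicNorm.nonneg _) (padicNorm.nonzero hr).symm
  have e1 : padicNorm 2 (2 * r) = 1 / 2 * padicNorm 2 r := by rw [padicNorm.mul, padicNorm_two]
  have e2 : padicNorm 2 (-r ^ 2) = padicNorm 2 r ^ 2 := by
    rw [padicNorm.neg, sq, sq, padicNorm.mul]
  have e3 : padicNorm 2 (2 * r ^ 2) = 1 / 2 * padicNorm 2 r ^ 2 := by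
    rw [padicNorm.mul, padicNorm_two, ← padicNorm.neg, e2]
  have e4 : padicNorm 2 (1 : ℚ) = 1 := padicNorm.one
  rw [ratioStep, padicNorm.div, e3, one_lt_div (by positivity)]
  rcases lt_or_gt_of_ne h with h | h
  · have h1 : padicNorm 2 (2 * r - r ^ 2) < 1 := by
      refine (padicNorm.sub (p := 2)).trans_lt ?_
      rw [← padicNorm.neg (r ^ 2), e1, e2, max_lt_iff]
      constructor <;> nlinarith
    rw [add_sub_assoc, padicNorm.add_eq_max_of_ne (by rw [e4]; exact h1.ne'), e4,
      max_eq_left h1.le]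
    nlinarith
  · have h1 : padicNorm 2 (1 + 2 * r) < padicNorm 2 (-r ^ 2) := by
      refine (padicNorm.nonarchimedean (p := 2)).trans_lt ?_
      rw [e1, e2, e4, max_lt_iff]
      constructor <;> nlinarith
    rw [sub_eq_add_neg, padicNorm.add_eq_max_of_ne h1.ne, max_eq_right h1.le, e2]
    nlinarith

/-- The 2-adic distance of `r` from the fixed points `1` and `-1` of `ratioStep`. -/
def twoAdicDist (r : ℚ) : ℚ := min (padicNorm 2 (1 - r)) (padicNorm 2 (1 + r))

/-- On 2-adic units `ratioStep` contracts towards its fixed points `1` and `-1`. -/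
lemma twoAdicDist_ratioStep_lt {r : ℚ} (hr : padicNorm 2 r = 1)
    (hr' : padicNorm 2 (ratioStep r) = 1) (h1 : r ≠ 1) (h2 : r ≠ -1) :
    twoAdicDist (ratioStep r) < twoAdicDist r := by
  have hr0 : r ≠ 0 := by
    rintro rfl
    simp at hr
  have hsq : padicNorm 2 (2 * r ^ 2) = 1 / 2 := by
    rw [padicNorm.mul, padicNorm_two, sq, padicNorm.mul, hr]; norm_num
  have hpos (x : ℚ) (hx : x ≠ 0) : 0 < padicNorm 2 x :=
    lt_of_le_of_ne (padicNorm.nonneg _) (padicNorm.nonzero hx).symm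
  have p1 := hpos (1 - r) (sub_ne_zero.2 h1.symm)
  have p2 := hpos (1 + r) (fun h => h2 (by linarith))
  have e1 : 1 - ratioStep r = -((1 - r) * (1 + 3 * r)) / (2 * r ^ 2) := by
    rw [ratioStep]; field_simp; ring
  have e2 : 1 + ratioStep r = (1 + r) * (1 + r) / (2 * r ^ 2) := by
    rw [ratioStep]; field_simp; ring
  -- Write `r = 1 - 2 u`; then `1 + r = 2 (1 - u)`, and one of `u`, `1 - u` is even.
  have h3 : padicNorm 2 (1 - r) ≤ 1 / 2 := by
    rcases padicNorm_two_le_half_or hr.le with h | h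
    · linarith
    · exact h
  have h4 : padicNorm 2 ((1 - r) / 2) ≤ 1 := by
    rw [padicNorm.div, padicNorm_two]; linarith
  rcases padicNorm_two_le_half_or h4 with h | h
  · have h5 : padicNorm 2 (1 - r) ≤ 1 / 4 := by
      rw [padicNorm.div, padicNorm_two] at h; linarith
    have h6 : padicNorm 2 (1 + r) = 1 / 2 := by
      rw [show 1 + r = 2 + -(1 - r) by ring, padicNorm.add_eq_max_of_ne, padicNorm.neg,
        padicNorm_two, max_eq_left (by linarith)]
      rw [padicNorm.neg, padicNorm_two]
      intro h; linarith
    have h7 : padicNorm 2 (1 + 3 * r) ≤ 1 / 4 := by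
      have h8 : padicNorm 2 (2 * 2 : ℚ) = 1 / 4 := by
        rw [padicNorm.mul, padicNorm_two]; norm_num
      have h9 : padicNorm 2 (3 * (1 - r)) ≤ 1 / 4 := by
        rw [padicNorm.mul]
        have : padicNorm 2 ((3 : ℤ) : ℚ) ≤ 1 := padicNorm.of_int 3
        push_cast at this
        nlinarith
      rw [show 1 + 3 * r = 2 * 2 - 3 * (1 - r) by ring]
      exact (padicNorm.sub (p := 2)).trans (max_le h8.le h9)
    unfold twoAdicDist
    rw [h6, min_eq_left (by linarith : padicNorm 2 (1 - r) ≤ 1 / 2)]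
    refine (min_le_left _ _).trans_lt ?_
    rw [e1, padicNorm.div, padicNorm.neg, padicNorm.mul, hsq, div_lt_iff₀ (by norm_num)]
    nlinarith
  · have h5 : padicNorm 2 (1 + r) ≤ 1 / 4 := by
      rw [show 1 + r = 2 * (1 - (1 - r) / 2) by ring, padicNorm.mul, padicNorm_two]; linarith
    have h6 : padicNorm 2 (1 - r) = 1 / 2 := by
      rw [show 1 - r = 2 + -(1 + r) by ring, padicNorm.add_eq_max_of_ne, padicNorm.neg,
        padicNorm_two, max_eq_left (by linarith)]
      rw [padicNorm.neg, padicNorm_two]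
      intro h; linarith
    unfold twoAdicDist
    rw [h6, min_eq_right (by linarith : padicNorm 2 (1 + r) ≤ 1 / 2)]
    refine (min_le_right _ _).trans_lt ?_
    rw [e2, padicNorm.div, padicNorm.mul, hsq, div_lt_iff₀ (by norm_num)]
    nlinarith

lemma not_forall_lt_succ_of_eq {a : ℕ → ℚ} {m n : ℕ} (hmn : m < n) (h : a n = a m) :
    ¬ ∀ i, m ≤ i → a i < a (i + 1) := by
  intro H
  have : ∀ i, m < i → a m < a i := by
    intro i hi
    induction i, hi using Nat.le_induction with
    | base => exact H m le_rfl
    | succ i hi ih => exact ih.trans (H i (by omega))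
  exact (this n hmn).ne' h

open Function in
/-- For `k = -1/2`, a nonzero periodic point has period one or two: the ratios of consecutive points
of the orbit are 2-adic units, as otherwise the orbit would escape to `∞`, and they contract towards
`1` or `-1`. -/
theorem affinePhi_neg_half_eq_or {b p : ℚ} (hp : p ≠ 0)
    (h : p ∈ periodicPts (affinePhi (-1 / 2) b)) :
    affinePhi (-1 / 2) b p = p ∨ affinePhi (-1 / 2) b p = -p := by
  obtain ⟨n, hn, h⟩ := h
  set f := affinePhi (-1 / 2) b with hf
  set z : ℕ → ℚ := fun i => f^[i] p with hz
  have hz0 (i : ℕ) : z i ≠ 0 := affinePhi_iterate_ne_zero hp hn h i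
  have hzs (i : ℕ) : z (i + 1) = f (z i) := iterate_succ_apply' f i p
  have hzn (i : ℕ) : z (i + n) = z i := by
    simp only [hz]
    rw [iterate_add_apply, h.eq]
  set r : ℕ → ℚ := fun i => z (i + 1) / z i with hr
  have hr0 (i : ℕ) : r i ≠ 0 := div_ne_zero (hz0 _) (hz0 _)
  have hrs (i : ℕ) : r (i + 1) = ratioStep (r i) := by
    have h0 := hz0 i
    have h1 := hz0 (i + 1)
    have a1 : b = z (i + 1) * z i + z i ^ 2 / 2 := by
      rw [hzs i, hf, affinePhi]; field_simp; ring
    have a2 : z (i + 1 + 1) = -1 / 2 * z (i + 1) + b / z (i + 1) := by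
      rw [hzs (i + 1), hf, affinePhi]
    simp only [hr, ratioStep]
    rw [a2, a1]
    field_simp
    ring
  have hrn (i : ℕ) : r (i + n) = r i := by
    simp only [hr]
    rw [hzn, show i + n + 1 = i + 1 + n by ring, hzn]
  have hunit (i : ℕ) : padicNorm 2 (r i) = 1 := by
    by_contra hi
    have hgt : ∀ j, i + 1 ≤ j → 1 < padicNorm 2 (r j) := by
      intro j hj
      induction j, hj using Nat.le_induction with
      | base => rw [hrs]; exact one_lt_padicNorm_ratioStep (hr0 i) hi
      | succ j _ ih => rw [hrs]; exact one_lt_padicNorm_ratioStep (hr0 j) ih.ne'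
    refine not_forall_lt_succ_of_eq (a := fun j => padicNorm 2 (z j)) (m := i + 1)
      (n := i + 1 + n) (by omega) (by simp only [hzn]) fun j hj => ?_
    have h1 := hgt j hj
    simp only [hr] at h1
    rwa [padicNorm.div, one_lt_div
      (lt_of_le_of_ne (padicNorm.nonneg _) (padicNorm.nonzero (hz0 j)).symm)] at h1
  have hone : ∃ i, r i = 1 ∨ r i = -1 := by
    by_contra! H
    refine not_forall_lt_succ_of_eq (a := fun j => -twoAdicDist (r j)) (m := 0) (n := 0 + n)
      (by omega) (by simp only [hrn]) fun j _ => ?_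
    simp only [neg_lt_neg_iff, hrs j]
    exact twoAdicDist_ratioStep_lt (hunit j) (hrs j ▸ hunit (j + 1)) (H j).1 (H j).2
  obtain ⟨i, hi⟩ := hone
  have hstay : ∀ j, i ≤ j → r j = 1 ∨ r j = -1 := by
    intro j hj
    induction j, hj using Nat.le_induction with
    | base => exact hi
    | succ j _ ih =>
      rw [hrs]
      rcases ih with ih | ih <;> rw [ih] <;> norm_num [ratioStep]
  have hmul (m : ℕ) : r (n * m) = r 0 := by
    induction m with
    | zero => simp
    | succ m ih => rw [Nat.mul_succ, hrn, ih]
  have h0 : r 0 = 1 ∨ r 0 = -1 := by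
    rw [← hmul i]
    exact hstay _ (Nat.le_mul_of_pos_left i hn)
  have e : r 0 = f p / p := by simp [hr, hz]
  rw [e, div_eq_iff hp, div_eq_iff hp, one_mul, neg_one_mul] at h0
  exact h0

end TwoAdic

/-! ### Possible periods -/

section Periods

open Function

variable {k b p : ℚ}

lemma affinePhi_eq_iff {z w : ℚ} (hz : z ≠ 0) : affinePhi k b z = w ↔ k * z ^ 2 + b = z * w := by
  rw [affinePhi]
  constructor
  · rintro rfl
    field_simp
  · intro h
    field_simp
    linear_combination h

lemma minimalPeriod_affinePhi_le_four (hManes : ManesConjecture) (hk : k ≠ 0) (hb : b ≠ 0)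
    (hp : p ≠ 0) : minimalPeriod (affinePhi k b) p ≤ 4 := by
  by_cases hk2 : k = -1 / 2
  · subst hk2
    by_cases hper : p ∈ periodicPts (affinePhi (-1 / 2) b)
    · have h2 : IsPeriodicPt (affinePhi (-1 / 2) b) 2 p := by
        change affinePhi _ _ (affinePhi _ _ p) = p
        rcases affinePhi_neg_half_eq_or hp hper with h | h
        · rw [h, h]
        · rw [h, affinePhi_neg_right, h, neg_neg]
      have := h2.minimalPeriod_le two_pos
      omega
    · rw [minimalPeriod_eq_zero_of_notMem_periodicPts hper]
      omega
  · by_contra! h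
    refine hManes (phi k b) (phi_mapDegree hk hb) (nonempty_autGroup_phi_mulEquiv hk hb hk2) _ h
      ⟨(p : OnePoint ℚ), ?_⟩
    exact minimalPeriod_coe hk hb hp

/-- A point of period three for `φ` would have period six for `-φ`, which is again a map of the
family. -/
lemma minimalPeriod_affinePhi_ne_three (hManes : ManesConjecture) (hk : k ≠ 0) (hb : b ≠ 0)
    (hp : p ≠ 0) : minimalPeriod (affinePhi k b) p ≠ 3 := by
  intro h
  have h3 : IsPeriodicPt (affinePhi k b) 3 p := h ▸ isPeriodicPt_minimalPeriod _ _
  have h1 : ¬ IsPeriodicPt (affinePhi k b) 2 p := by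
    rw [isPeriodicPt_iff_minimalPeriod_dvd, h]
    omega
  set f := affinePhi k b with hf
  set g := affinePhi (-k) (-b) with hg
  have hgf (z : ℚ) : g z = -f z := affinePhi_neg_neg k b z
  have hfn (z : ℚ) : f (-z) = -f z := affinePhi_neg_right k b z
  have e3 : f (f (f p)) = p := h3
  have g2 : g (g p) = f (f p) := by simp only [hgf, hfn, neg_neg]
  have g3 : g (g (g p)) = -p := by rw [g2, hgf, e3]
  have g6 : IsPeriodicPt g 6 p := by
    change g (g (g (g (g (g p))))) = p
    rw [g3]
    simp only [hgf, hfn, neg_neg, e3]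
  have hle : minimalPeriod g p ≤ 4 :=
    minimalPeriod_affinePhi_le_four hManes (neg_ne_zero.2 hk) (neg_ne_zero.2 hb) hp
  have hdvd := g6.minimalPeriod_dvd
  have h23 : minimalPeriod g p ∣ 2 ∨ minimalPeriod g p ∣ 3 := by
    have hpos := g6.minimalPeriod_pos (by norm_num)
    generalize minimalPeriod g p = n at *
    interval_cases n <;> omega
  rw [← isPeriodicPt_iff_minimalPeriod_dvd, ← isPeriodicPt_iff_minimalPeriod_dvd] at h23
  rcases h23 with h' | h'
  · exact h1 (g2.symm.trans h')
  · have : -p = p := g3.symm.trans h'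
    exact hp (by linarith)

lemma affinePhi_eq_or_neg_of_period_two (hk : k ≠ 0) (hp : p ≠ 0)
    (h : IsPeriodicPt (affinePhi k b) 2 p) : affinePhi k b p = p ∨ affinePhi k b p = -p := by
  have hq : affinePhi k b p ≠ 0 := affinePhi_iterate_ne_zero hp two_pos h 1
  have h' : affinePhi k b (affinePhi k b p) = p := h
  have e1 := (affinePhi_eq_iff (k := k) (b := b) hp).1 rfl
  rw [affinePhi_eq_iff hq] at h'
  have : k * (affinePhi k b p ^ 2 - p ^ 2) = 0 := by linear_combination h' - e1
  have := (mul_eq_zero.1 this).resolve_left hk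
  exact sq_eq_sq_iff_eq_or_eq_neg.1 (by linear_combination this)

/-- A cycle `A, B, C, D` of exact period four with `C ≠ -A` would give the rational solution
`m = (A + C) / (B + D)`, `n = (A - C) / (B - D)` of `m - 1 / m = n + 1 / n`, that is, a point on
`y² = m⁴ - 6 m² + 1`. -/
lemma affinePhi_sq_eq_neg_of_period_four (hp : p ≠ 0) (h : IsPeriodicPt (affinePhi k b) 4 p)
    (h2 : ¬ IsPeriodicPt (affinePhi k b) 2 p) : affinePhi k b (affinePhi k b p) = -p := by
  have hne := affinePhi_iterate_ne_zero hp (by norm_num) h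
  have hB : affinePhi k b p ≠ 0 := hne 1
  have hC : affinePhi k b (affinePhi k b p) ≠ 0 := hne 2
  have hD : affinePhi k b (affinePhi k b (affinePhi k b p)) ≠ 0 := hne 3
  have h4 : affinePhi k b (affinePhi k b (affinePhi k b (affinePhi k b p))) = p := h
  have hAC : affinePhi k b (affinePhi k b p) ≠ p := h2
  have hBD : affinePhi k b (affinePhi k b (affinePhi k b p)) ≠ affinePhi k b p := by
    intro h'
    rw [h'] at h4
    exact hAC h4
  generalize eD : affinePhi k b (affinePhi k b (affinePhi k b p)) = D at *
  generalize eC : affinePhi k b (affinePhi k b p) = C at *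
  generalize eB : affinePhi k b p = B at *
  rw [affinePhi_eq_iff (by assumption)] at eB eC eD h4
  by_contra hu
  have hu : p + C ≠ 0 := fun h' => hu (by linarith)
  have hv : p - C ≠ 0 := sub_ne_zero.2 hAC.symm
  have ht : B - D ≠ 0 := sub_ne_zero.2 hBD.symm
  have e1 : 2 * k * (p + C) * (p - C) = (p + C) * (B - D) + (p - C) * (B + D) := by
    linear_combination 2 * (eB - eD)
  have e2 : 2 * k * (B + D) * (B - D) = (p + C) * (B - D) - (p - C) * (B + D) := by
    linear_combination 2 * (eC - h4)
  have hs : B + D ≠ 0 := by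
    intro hs
    rw [hs] at e2
    have : (p + C) * (B - D) = 0 := by linear_combination -e2
    simp_all
  generalize p + C = u at *
  generalize p - C = v at *
  generalize B + D = s at *
  generalize B - D = t at *
  have e3 : u * s * (v ^ 2 + t ^ 2) = v * t * (u ^ 2 - s ^ 2) := by
    linear_combination u * v * e2 - s * t * e1
  refine sq_sub_one_sq_sub_ne_sq (m := u / s) (y := 2 * (u / s) * (v / t) - ((u / s) ^ 2 - 1))
    (div_ne_zero hu hs) ?_
  have e4 : u / s * ((v / t) ^ 2 + 1) = v / t * ((u / s) ^ 2 - 1) := by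
    field_simp
    linear_combination e3
  linear_combination -4 * (u / s) * e4

theorem affinePhi_trichotomy (hManes : ManesConjecture) (hk : k ≠ 0) (hb : b ≠ 0) (hp : p ≠ 0)
    (h : p ∈ periodicPts (affinePhi k b)) :
    affinePhi k b p = p ∨ affinePhi k b p = -p ∨ affinePhi k b (affinePhi k b p) = -p := by
  have hpos := minimalPeriod_pos_of_mem_periodicPts h
  have hle := minimalPeriod_affinePhi_le_four hManes hk hb hp
  have hne := minimalPeriod_affinePhi_ne_three hManes hk hb hp
  by_cases h2 : IsPeriodicPt (affinePhi k b) 2 p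
  · exact (affinePhi_eq_or_neg_of_period_two hk hp h2).imp_right Or.inl
  · refine Or.inr (Or.inr (affinePhi_sq_eq_neg_of_period_four hp ?_ h2))
    rw [isPeriodicPt_iff_minimalPeriod_dvd] at h2 ⊢
    generalize minimalPeriod (affinePhi k b) p = n at *
    interval_cases n <;> omega

lemma minimalPeriod_affinePhi_eq_two_iff (hk : k ≠ 0) (hp : p ≠ 0) :
    minimalPeriod (affinePhi k b) p = 2 ↔ affinePhi k b p = -p := by
  rw [minimalPeriod_eq_prime_iff]
  constructor
  · rintro ⟨h, h1⟩
    exact (affinePhi_eq_or_neg_of_period_two hk hp h).resolve_left h1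
  · intro h
    constructor
    · change affinePhi _ _ (affinePhi _ _ p) = p
      rw [h, affinePhi_neg_right, h, neg_neg]
    · intro h1
      exact hp (by linarith [h.symm.trans h1])

lemma minimalPeriod_affinePhi_eq_four_iff (hp : p ≠ 0) :
    minimalPeriod (affinePhi k b) p = 4 ↔ affinePhi k b (affinePhi k b p) = -p := by
  constructor
  · intro h
    refine affinePhi_sq_eq_neg_of_period_four hp (h ▸ isPeriodicPt_minimalPeriod _ _) ?_
    rw [isPeriodicPt_iff_minimalPeriod_dvd, h]
    omega
  · intro h
    refine minimalPeriod_eq_prime_pow (p := 2) (k := 1) ?_ ?_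
    · change ¬ affinePhi k b (affinePhi k b p) = p
      rw [h]
      intro h'
      exact hp (by linarith)
    · change affinePhi k b (affinePhi k b (affinePhi k b (affinePhi k b p))) = p
      rw [h, affinePhi_neg_right, affinePhi_neg_right, h, neg_neg]

end Periods

/-! ### The entries of the table -/

section Table

open Function

variable {k b p s : ℚ}

lemma setOf_minimalPeriod_eq (hk : k ≠ 0) (hb : b ≠ 0) {n : ℕ} (hn : 0 < n) :
    {q : ℚ | minimalPeriod ((phi k b).projMap ℚ) (q : OnePoint ℚ) = n} =
      {q : ℚ | q ≠ 0 ∧ minimalPeriod (affinePhi k b) q = n} := by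
  ext q
  by_cases hq : q = 0
  · subst hq
    simp [minimalPeriod_coe_zero hk hb, hn.ne]
  · simp [minimalPeriod_coe hk hb hq, hq]

lemma period_one_entry (hp : p ≠ 0) (hs : s ∉ ({0, 1} : Set ℚ)) :
    1 - s ≠ 0 ∧ s * p ^ 2 ≠ 0 ∧
      {q : ℚ | minimalPeriod ((phi (1 - s) (s * p ^ 2)).projMap ℚ) (q : OnePoint ℚ) = 1} =
        {p, -p} := by
  simp only [Set.mem_insert_iff, Set.mem_singleton_iff, not_or] at hs
  have hk : 1 - s ≠ 0 := sub_ne_zero.2 (Ne.symm hs.2)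
  have hb : s * p ^ 2 ≠ 0 := mul_ne_zero hs.1 (pow_ne_zero 2 hp)
  refine ⟨hk, hb, ?_⟩
  rw [setOf_minimalPeriod_eq hk hb one_pos]
  ext q
  simp only [Set.mem_ofPred_eq, Set.mem_insert_iff, Set.mem_singleton_iff]
  rw [← sq_eq_sq_iff_eq_or_eq_neg, minimalPeriod_eq_one_iff_isFixedPt]
  constructor
  · rintro ⟨hq, h⟩
    have h := (affinePhi_eq_iff hq).1 h
    exact mul_left_cancel₀ hs.1 (by linear_combination -h)
  · intro h
    have hq : q ≠ 0 := pow_ne_zero_iff two_ne_zero |>.1 (h ▸ pow_ne_zero 2 hp)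
    exact ⟨hq, (affinePhi_eq_iff hq).2 (by linear_combination -s * h)⟩

lemma period_two_entry (hp : p ≠ 0) (hs : s ∉ ({0, 1} : Set ℚ)) :
    s - 1 ≠ 0 ∧ -s * p ^ 2 ≠ 0 ∧
      {q : ℚ | minimalPeriod ((phi (s - 1) (-s * p ^ 2)).projMap ℚ) (q : OnePoint ℚ) = 2} =
        {p, -p} := by
  simp only [Set.mem_insert_iff, Set.mem_singleton_iff, not_or] at hs
  have hk : s - 1 ≠ 0 := sub_ne_zero.2 hs.2
  have hb : -s * p ^ 2 ≠ 0 := mul_ne_zero (neg_ne_zero.2 hs.1) (pow_ne_zero 2 hp)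
  refine ⟨hk, hb, ?_⟩
  rw [setOf_minimalPeriod_eq hk hb two_pos]
  ext q
  simp only [Set.mem_ofPred_eq, Set.mem_insert_iff, Set.mem_singleton_iff]
  rw [← sq_eq_sq_iff_eq_or_eq_neg]
  constructor
  · rintro ⟨hq, h⟩
    rw [minimalPeriod_affinePhi_eq_two_iff hk hq, affinePhi_eq_iff hq] at h
    exact mul_left_cancel₀ hs.1 (by linear_combination h)
  · intro h
    have hq : q ≠ 0 := pow_ne_zero_iff two_ne_zero |>.1 (h ▸ pow_ne_zero 2 hp)
    refine ⟨hq, ?_⟩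
    rw [minimalPeriod_affinePhi_eq_two_iff hk hq, affinePhi_eq_iff hq]
    linear_combination s * h

lemma period_four_entry (hp : p ≠ 0) (hs : s ∉ ({0, 1, -1} : Set ℚ)) :
    2 * s / (s ^ 2 - 1) ≠ 0 ∧ -(p ^ 2 * (s ^ 2 + 1) / (s * (s ^ 2 - 1))) ≠ 0 ∧
      {q : ℚ | minimalPeriod ((phi (2 * s / (s ^ 2 - 1))
        (-(p ^ 2 * (s ^ 2 + 1) / (s * (s ^ 2 - 1))))).projMap ℚ) (q : OnePoint ℚ) = 4} =
        {p, p / s, -p, -(p / s)} := by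
  simp only [Set.mem_insert_iff, Set.mem_singleton_iff, not_or] at hs
  obtain ⟨hs0, hs1, hs2⟩ := hs
  have hd : s ^ 2 - 1 ≠ 0 := by
    rw [show s ^ 2 - 1 = (s - 1) * (s + 1) by ring]
    exact mul_ne_zero (sub_ne_zero.2 hs1) (fun h => hs2 (by linarith))
  have hd' : s ^ 2 + 1 ≠ 0 := by positivity
  have hk : 2 * s / (s ^ 2 - 1) ≠ 0 := div_ne_zero (mul_ne_zero two_ne_zero hs0) hd
  have hb : -(p ^ 2 * (s ^ 2 + 1) / (s * (s ^ 2 - 1))) ≠ 0 :=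
    neg_ne_zero.2 (div_ne_zero (mul_ne_zero (pow_ne_zero 2 hp) hd') (mul_ne_zero hs0 hd))
  refine ⟨hk, hb, ?_⟩
  rw [setOf_minimalPeriod_eq hk hb (by norm_num)]
  generalize ek : 2 * s / (s ^ 2 - 1) = k at *
  generalize eb : -(p ^ 2 * (s ^ 2 + 1) / (s * (s ^ 2 - 1))) = b at *
  have hps : p / s ≠ 0 := div_ne_zero hp hs0
  have f1 : affinePhi k b p = p / s := by
    rw [affinePhi_eq_iff hp, ← ek, ← eb]
    field_simp
    ring
  have f2 : affinePhi k b (p / s) = -p := by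
    rw [affinePhi_eq_iff hps, ← ek, ← eb]
    field_simp
    ring
  have ek' : k * (s ^ 2 - 1) = 2 * s := by
    rw [← ek]
    field_simp
  have eb' : b * (s * (s ^ 2 - 1)) = -(p ^ 2 * (s ^ 2 + 1)) := by
    rw [← eb]
    field_simp
  ext q
  simp only [Set.mem_ofPred_eq, Set.mem_insert_iff, Set.mem_singleton_iff]
  constructor
  · rintro ⟨hq, h⟩
    have hw : affinePhi k b q ≠ 0 :=
      affinePhi_iterate_ne_zero hq (by norm_num) (h ▸ isPeriodicPt_minimalPeriod _ _) 1
    rw [minimalPeriod_affinePhi_eq_four_iff hq] at h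
    generalize ew : affinePhi k b q = w at *
    rw [affinePhi_eq_iff (by assumption)] at ew h
    have g1 : (q - s * w) * (s * q + w) = 0 := by
      linear_combination (s ^ 2 - 1) / 2 * (ew - h) - (q ^ 2 - w ^ 2) / 2 * ek'
    have g2 : s ^ 2 * (q ^ 2 + w ^ 2) = p ^ 2 * (s ^ 2 + 1) := by
      linear_combination s * (s ^ 2 - 1) / 2 * (ew + h) - s * (q ^ 2 + w ^ 2) / 2 * ek' - eb'
    rcases mul_eq_zero.1 g1 with g | g
    · have : q ^ 2 = p ^ 2 := by
        refine mul_right_cancel₀ hd' ?_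
        linear_combination g2 + (q + s * w) * g
      rcases sq_eq_sq_iff_eq_or_eq_neg.1 this with h | h <;> simp [h]
    · have : (s * q) ^ 2 = p ^ 2 := by
        refine mul_right_cancel₀ hd' ?_
        linear_combination g2 + s ^ 2 * (s * q - w) * g
      rcases sq_eq_sq_iff_eq_or_eq_neg.1 this with h | h
      · exact Or.inr (Or.inl (by field_simp; linear_combination h))
      · exact Or.inr (Or.inr (Or.inr (by field_simp; linear_combination h)))
  · have main (q : ℚ) (hq : q ≠ 0) (h : affinePhi k b (affinePhi k b q) = -q) :
        q ≠ 0 ∧ minimalPeriod (affinePhi k b) q = 4 :=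
      ⟨hq, (minimalPeriod_affinePhi_eq_four_iff hq).2 h⟩
    rintro (rfl | rfl | rfl | rfl)
    · exact main _ hp (by rw [f1, f2])
    · exact main _ hps (by rw [f2, affinePhi_neg_right, f1])
    · exact main _ (neg_ne_zero.2 hp) (by simp only [affinePhi_neg_right, f1, f2])
    · exact main _ (neg_ne_zero.2 hps) (by simp only [affinePhi_neg_right, f1, f2])

/-- The parameters of a map with a given periodic point. In the last case, `s` is the ratio
`p / φ(p)`. -/
lemma exists_parameter_of_mem_periodicPts (hManes : ManesConjecture) (hk : k ≠ 0) (hb : b ≠ 0)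
    (hp : p ≠ 0) (h : (p : OnePoint ℚ) ∈ periodicPts ((phi k b).projMap ℚ)) :
    (∃ s ∉ ({0, 1} : Set ℚ), k = 1 - s ∧ b = s * p ^ 2) ∨
    (∃ s ∉ ({0, 1} : Set ℚ), k = s - 1 ∧ b = -s * p ^ 2) ∨
    (∃ s ∉ ({0, 1, -1} : Set ℚ), k = 2 * s / (s ^ 2 - 1) ∧
      b = -(p ^ 2 * (s ^ 2 + 1) / (s * (s ^ 2 - 1)))) := by
  obtain ⟨n, hn, h⟩ := h
  have h := (isPeriodicPt_coe_iff hk hb hp n).1 h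
  rcases affinePhi_trichotomy hManes hk hb hp ⟨n, hn, h⟩ with e | e | e
  · rw [affinePhi_eq_iff hp] at e
    have hb' : b = (1 - k) * p ^ 2 := by linear_combination e
    refine Or.inl ⟨1 - k, ?_, by ring, hb'⟩
    simp only [Set.mem_insert_iff, Set.mem_singleton_iff, not_or]
    refine ⟨fun h0 => hb (by rw [hb', h0, zero_mul]), fun h1 => hk (by linarith)⟩
  · rw [affinePhi_eq_iff hp] at e
    have hb' : b = -(k + 1) * p ^ 2 := by linear_combination e
    refine Or.inr (Or.inl ⟨k + 1, ?_, by ring, hb'⟩)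
    simp only [Set.mem_insert_iff, Set.mem_singleton_iff, not_or]
    refine ⟨fun h0 => hb (by rw [hb', h0, neg_zero, zero_mul]), fun h1 => hk (by linarith)⟩
  · have hw : affinePhi k b p ≠ 0 := affinePhi_iterate_ne_zero hp hn h 1
    generalize ew : affinePhi k b p = w at *
    rw [affinePhi_eq_iff (by assumption)] at ew e
    have g1 : k * (p ^ 2 - w ^ 2) = 2 * p * w := by linear_combination ew - e
    have hd : p ^ 2 - w ^ 2 ≠ 0 := by
      intro h0
      rw [h0, mul_zero] at g1
      exact mul_ne_zero (mul_ne_zero two_ne_zero hp) hw g1.symm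
    have hk' : k = 2 * p * w / (p ^ 2 - w ^ 2) := by rw [eq_div_iff hd, g1]
    have hb' : b = p * w - k * p ^ 2 := by linear_combination ew
    have hd' : (p / w) ^ 2 - 1 ≠ 0 := by
      rw [div_pow, div_sub_one (pow_ne_zero 2 hw)]
      exact div_ne_zero hd (pow_ne_zero 2 hw)
    refine Or.inr (Or.inr ⟨p / w, ?_, ?_, ?_⟩)
    · simp only [Set.mem_insert_iff, Set.mem_singleton_iff, not_or]
      refine ⟨div_ne_zero hp hw, fun h1 => hd' (by rw [h1]; ring), fun h1 => hd' (by rw [h1]; ring)⟩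
    · rw [hk']
      field_simp
    · rw [hb', hk']
      field_simp
      ring

lemma CommonPeriodicTable.mem_and_pos {k₁ b₁ k₂ b₂ : ℚ} {S₁ S₂ : Set ℚ} {n₁ n₂ : ℕ}
    (h : CommonPeriodicTable p k₁ b₁ S₁ n₁ k₂ b₂ S₂ n₂) :
    (p ∈ S₁ ∧ 0 < n₁) ∧ (p ∈ S₂ ∧ 0 < n₂) := by
  cases h <;> simp

lemma CommonPeriodicTable.entries {k₁ b₁ k₂ b₂ : ℚ} {S₁ S₂ : Set ℚ} {n₁ n₂ : ℕ} (hp : p ≠ 0)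
    (h : CommonPeriodicTable p k₁ b₁ S₁ n₁ k₂ b₂ S₂ n₂) :
    (k₁ ≠ 0 ∧ b₁ ≠ 0 ∧ k₂ ≠ 0 ∧ b₂ ≠ 0) ∧
      {q : ℚ | minimalPeriod ((phi k₁ b₁).projMap ℚ) (q : OnePoint ℚ) = n₁} = S₁ ∧
      {q : ℚ | minimalPeriod ((phi k₂ b₂).projMap ℚ) (q : OnePoint ℚ) = n₂} = S₂ := by
  have combine {k b k' b' : ℚ} {S S' : Set ℚ} {n n' : ℕ}
      (h : k ≠ 0 ∧ b ≠ 0 ∧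
        {q : ℚ | minimalPeriod ((phi k b).projMap ℚ) (q : OnePoint ℚ) = n} = S)
      (h' : k' ≠ 0 ∧ b' ≠ 0 ∧
        {q : ℚ | minimalPeriod ((phi k' b').projMap ℚ) (q : OnePoint ℚ) = n'} = S') :
      (k ≠ 0 ∧ b ≠ 0 ∧ k' ≠ 0 ∧ b' ≠ 0) ∧
      {q : ℚ | minimalPeriod ((phi k b).projMap ℚ) (q : OnePoint ℚ) = n} = S ∧
      {q : ℚ | minimalPeriod ((phi k' b').projMap ℚ) (q : OnePoint ℚ) = n'} = S' :=
    ⟨⟨h.1, h.2.1, h'.1, h'.2.1⟩, h.2.2, h'.2.2⟩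
  cases h with
  | row11 s₁ s₂ h₁ h₂ => exact combine (period_one_entry hp h₁) (period_one_entry hp h₂)
  | row22 s₁ s₂ h₁ h₂ => exact combine (period_two_entry hp h₁) (period_two_entry hp h₂)
  | row44 s₁ s₂ h₁ h₂ => exact combine (period_four_entry hp h₁) (period_four_entry hp h₂)
  | row12 s₁ s₂ h₁ h₂ => exact combine (period_one_entry hp h₁) (period_two_entry hp h₂)
  | row14 s₁ s₂ h₁ h₂ => exact combine (period_one_entry hp h₁) (period_four_entry hp h₂)
  | row24 s₁ s₂ h₁ h₂ => exact combine (period_two_entry hp h₁) (period_four_entry hp h₂)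

lemma CommonPeriodicTable.mem_periodicPts {k₁ b₁ k₂ b₂ : ℚ} {S₁ S₂ : Set ℚ} {n₁ n₂ : ℕ}
    (hp : p ≠ 0) (h : CommonPeriodicTable p k₁ b₁ S₁ n₁ k₂ b₂ S₂ n₂) :
    (p : OnePoint ℚ) ∈ periodicPts ((phi k₁ b₁).projMap ℚ) ∧
      (p : OnePoint ℚ) ∈ periodicPts ((phi k₂ b₂).projMap ℚ) := by
  obtain ⟨⟨h₁, hn₁⟩, h₂, hn₂⟩ := h.mem_and_pos
  obtain ⟨-, e₁, e₂⟩ := h.entries hp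
  rw [← e₁, Set.mem_ofPred_eq] at h₁
  rw [← e₂, Set.mem_ofPred_eq] at h₂
  exact ⟨minimalPeriod_pos_iff_mem_periodicPts.1 (h₁ ▸ hn₁),
    minimalPeriod_pos_iff_mem_periodicPts.1 (h₂ ▸ hn₂)⟩

end Table

theorem mainTheorem3 (hManes : ManesConjecture) :
    (∀ k₁ b₁ k₂ b₂ : ℚ, k₁ ≠ 0 → b₁ ≠ 0 → k₂ ≠ 0 → b₂ ≠ 0 → ∀ p : ℚ, p ≠ 0 →
      (((p : OnePoint ℚ) ∈ Function.periodicPts ((phi k₁ b₁).projMap ℚ) ∧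
          (p : OnePoint ℚ) ∈ Function.periodicPts ((phi k₂ b₂).projMap ℚ)) ↔
        ∃ (S₁ : Set ℚ) (n₁ : ℕ) (S₂ : Set ℚ) (n₂ : ℕ),
          CommonPeriodicTable p k₁ b₁ S₁ n₁ k₂ b₂ S₂ n₂ ∨
          CommonPeriodicTable p k₂ b₂ S₂ n₂ k₁ b₁ S₁ n₁)) ∧
    (∀ p : ℚ, p ≠ 0 → ∀ (k₁ b₁ : ℚ) (S₁ : Set ℚ) (n₁ : ℕ) (k₂ b₂ : ℚ) (S₂ : Set ℚ) (n₂ : ℕ),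
      CommonPeriodicTable p k₁ b₁ S₁ n₁ k₂ b₂ S₂ n₂ →
        (k₁ ≠ 0 ∧ b₁ ≠ 0 ∧ k₂ ≠ 0 ∧ b₂ ≠ 0) ∧
        {q : ℚ | Function.minimalPeriod ((phi k₁ b₁).projMap ℚ) (q : OnePoint ℚ) = n₁} = S₁ ∧
        {q : ℚ | Function.minimalPeriod ((phi k₂ b₂).projMap ℚ) (q : OnePoint ℚ) = n₂} = S₂) := by
  refine ⟨?_, fun p hp k₁ b₁ S₁ n₁ k₂ b₂ S₂ n₂ h => h.entries hp⟩
  intro k₁ b₁ k₂ b₂ hk₁ hb₁ hk₂ hb₂ p hp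
  constructor
  · rintro ⟨h₁, h₂⟩
    rcases exists_parameter_of_mem_periodicPts hManes hk₁ hb₁ hp h₁ with
      ⟨s₁, hs₁, rfl, rfl⟩ | ⟨s₁, hs₁, rfl, rfl⟩ | ⟨s₁, hs₁, rfl, rfl⟩ <;>
    rcases exists_parameter_of_mem_periodicPts hManes hk₂ hb₂ hp h₂ with
      ⟨s₂, hs₂, rfl, rfl⟩ | ⟨s₂, hs₂, rfl, rfl⟩ | ⟨s₂, hs₂, rfl, rfl⟩
    · exact ⟨_, _, _, _, Or.inl (.row11 s₁ s₂ hs₁ hs₂)⟩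
    · exact ⟨_, _, _, _, Or.inl (.row12 s₁ s₂ hs₁ hs₂)⟩
    · exact ⟨_, _, _, _, Or.inl (.row14 s₁ s₂ hs₁ hs₂)⟩
    · exact ⟨_, _, _, _, Or.inr (.row12 s₂ s₁ hs₂ hs₁)⟩
    · exact ⟨_, _, _, _, Or.inl (.row22 s₁ s₂ hs₁ hs₂)⟩
    · exact ⟨_, _, _, _, Or.inl (.row24 s₁ s₂ hs₁ hs₂)⟩
    · exact ⟨_, _, _, _, Or.inr (.row14 s₂ s₁ hs₂ hs₁)⟩
    · exact ⟨_, _, _, _, Or.inr (.row24 s₂ s₁ hs₂ hs₁)⟩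
    · exact ⟨_, _, _, _, Or.inl (.row44 s₁ s₂ hs₁ hs₂)⟩
  · rintro ⟨S₁, n₁, S₂, n₂, h | h⟩
    · exact h.mem_periodicPts hp
    · exact (h.mem_periodicPts hp).symm
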